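/- **Setting.** Let $U\subset\mathbf R^m$ be nonempty and bounded, let $\bar v\in\mathbf R^k$ be known, and put $V=\{\bar v\}$. Let $v\mapsto M(v)$ be an affine map from $\mathbf R^k$ to the $d\times d$ real matrices with $M(\bar v)$ symmetric, $M(\bar v)\succ0$. Let $A$ be a $d\times(m+1)$ real matrix whose first $m$ columns are linearly independent, $Q$ a symmetric $(m+1)\times(m+1)$ matrix, $q\in\mathbf R^k$, $\epsilon\in(0,1)$. From an i.i.d. sample $\zeta^K=(\zeta_1,\dots,\zeta_K)$, $\zeta_i\sim P_{u,\bar v}:=\mathcal N(A[u;1],M(\bar v))$, with unknown $u\in U$, one wants to estimate $F(u,\bar v)=[u;1]^TQ[u;1]+q^T\bar v$. The $\epsilon$-risk of an estimate $\widehat g:(\mathbf R^d)^K\to\mathbf R$ is $$\mathrm{Risk}_\epsilon(\widehat g)=\inf\Big\{\rho\in\mathbf R:\ \mathrm{Prob}_{\zeta^K\sim P_{u,\bar v}^K}\{|\widehat g(\zeta^K)-F(u,\bar v)|>\rho\}\le\epsilon\ \ \forall u\in U\Big\}$$ ($=+\infty$ if there is no such $\rho$). **Construction.** Let $\mathcal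 Z$ be a convex compact set of positive semidefinite $(m+1)\times(m+1)$ matrices $Z$ with $Z_{m+1,m+1}=1$, containing $[u;1][u;1]^T$ for every $u\in U$. Let $\Theta_*\succ0$ and $\delta\in[0,2]$ satisfy $M(\bar v)\preceq\Theta_*$ and $\|M(\bar v)^{1/2}\Theta_*^{-1/2}-I\|\le\delta$ in the spectral norm (for example $\Theta_*=M(\bar v)$, $\delta=0$), and let $\gamma\in(0,1)$. Set $B=[A;e_{m+1}^T]$, where $e_{m+1}$ is the last standard basis vector of $\mathbf R^{m+1}$, and $G(v,Z)=\mathrm{Tr}(QZ)+q^Tv$. For $h\in\mathbf R^d$, symmetric $d\times d$ matrices $H$ with $-\gamma\Theta_*^{-1}\preceq H\preceq\gamma\Theta_*^{-1}$, $d\times d$ matrices $\Theta$ and $(d+1)\times(d+1)$ matrices $W$, put $$\Phi(h,H;\Theta,W)=-\tfrac12\ln\det(I-\Theta_*^{1/2}H\Theta_*^{1/2})+\tfrac12\mathrm{Tr}([\Theta-\Theta_*]H)+\frac{\delta(2+\delta)}{2(1-\|\Theta_*^{1/2}H\Theta_*^{1/2}\|)}\|\Theta_*^{1/2}H\Theta_*^{1/2}\|_F^2$$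 $$\qquad+\tfrac12\mathrm{Tr}\left(W\left[\begin{bmatrix}H&h\\h^T&0\end{bmatrix}+[H,h]^T[\Theta_*^{-1}-H]^{-1}[H,h]\right]\right),$$ where $\|\cdot\|$ is the spectral and $\|\cdot\|_F$ the Frobenius norm. For $h\in\mathbf R^d$, symmetric $H$ and $K\ge1$, put $$\widehat\Psi^K_\pm(h,H)=\sup_{Z\in\mathcal Z}\ \inf_{\alpha>0,\ -\gamma\alpha\Theta_*^{-1}\preceq H\preceq\gamma\alpha\Theta_*^{-1}}\Big\{\alpha\,\Phi\big(\pm\tfrac h\alpha,\pm\tfrac H\alpha;M(\bar v),BZB^T\big)\mp G(\bar v,Z)+\tfrac\alpha K\ln\tfrac2\epsilon\Big\}.$$ For an $(m+1)\times(d+1)$ matrix $C$, define $(\bar h,\bar H)$ by $$\begin{bmatrix}\bar H&\bar h\\\bar h^T&0\end{bmatrix}=2[C^TQC]^o,$$ where $S^o$ is $S$ with the entry $S_{d+1,d+1}$ replaced by $0$. The estimate is $$\widehat g_K(\zeta^K)=\frac1K\sum_{i=1}^K\Big[\bar h^T\zeta_i+\tfrac12\zeta_i^T\bar H\zeta_i\Big]+\varkappa_K,\qquad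 \varkappa_K=\tfrac12\big[\widehat\Psi^K_-(\bar h,\bar H)-\widehat\Psi^K_+(\bar h,\bar H)\big].$$ **Proposition.** In this situation a matrix $C$ with $CB=I_{m+1}$ exists, and for every such $C$ the resulting estimates satisfy $\mathrm{Risk}_\epsilon(\widehat g_K)\to0$ as $K\to\infty$. -/

import Mathlib

open Matrix MeasureTheory ProbabilityTheory Filter Topology

noncomputable section

namespace QuadLift

/-! Vectors of dimension `n + 1` are indexed by `Fin n ⊕ Unit`: the last coordinate is
`Sum.inr ()`, so that `n + 1`-dimensional matrices come with their natural block structure. -/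

/-- The vector `[u; 1]`. -/
def ext1 {n : ℕ} (u : Fin n → ℝ) : Fin n ⊕ Unit → ℝ :=
  Sum.elim u (fun _ => 1)

/-- The rank-one matrix `[u; 1] [u; 1]ᵀ`. -/
def lift {n : ℕ} (u : Fin n → ℝ) : Matrix (Fin n ⊕ Unit) (Fin n ⊕ Unit) ℝ :=
  vecMulVec (ext1 u) (ext1 u)

/-- The `(d+1) × (m+1)` matrix `B = [A; eᵀ]`, where `e` is the last standard basis vector. -/
def matB {m d : ℕ} (A : Matrix (Fin d) (Fin m ⊕ Unit) ℝ) :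
    Matrix (Fin d ⊕ Unit) (Fin m ⊕ Unit) ℝ :=
  fromRows A (replicateRow Unit (Pi.single (Sum.inr ()) 1))

/-- The functional of interest `F(u, v) = [u;1]ᵀ Q [u;1] + qᵀ v`. -/
def functionalF {m k : ℕ} (Q : Matrix (Fin m ⊕ Unit) (Fin m ⊕ Unit) ℝ) (q : Fin k → ℝ)
    (u : Fin m → ℝ) (v : Fin k → ℝ) : ℝ :=
  ext1 u ⬝ᵥ (Q *ᵥ ext1 u) + q ⬝ᵥ v

/-- Its linear counterpart `G(v, Z) = Tr(Q Z) + qᵀ v`. -/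
def functionalG {m k : ℕ} (Q : Matrix (Fin m ⊕ Unit) (Fin m ⊕ Unit) ℝ) (q : Fin k → ℝ)
    (v : Fin k → ℝ) (Z : Matrix (Fin m ⊕ Unit) (Fin m ⊕ Unit) ℝ) : ℝ :=
  (Q * Z).trace + q ⬝ᵥ v

open scoped MatrixOrder in
/-- The positive semidefinite square root of a positive semidefinite matrix. -/
def msqrt {d : ℕ} (S : Matrix (Fin d) (Fin d) ℝ) : Matrix (Fin d) (Fin d) ℝ :=
  CFC.sqrt S

/-- The spectral norm. -/
def specNorm {d : ℕ} (S : Matrix (Fin d) (Fin d) ℝ) : ℝ :=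
  ‖toEuclideanCLM (n := Fin d) (𝕜 := ℝ) S‖

/-- The square of the Frobenius norm. -/
def frobSq {d : ℕ} (S : Matrix (Fin d) (Fin d) ℝ) : ℝ :=
  ∑ i, ∑ j, S i j ^ 2

/-- `Θs` and `δ` dominate the covariance set `𝒱`: `Θs ≻ 0`, `δ ∈ [0, 2]`, and
`Θ ⪯ Θs`, `‖Θ^{1/2} Θs^{-1/2} - I‖ ≤ δ` for all `Θ ∈ 𝒱`. -/
def Dominates {d : ℕ} (Θs : Matrix (Fin d) (Fin d) ℝ) (δ : ℝ)
    (𝒱 : Set (Matrix (Fin d) (Fin d) ℝ)) : Prop :=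
  Θs.PosDef ∧ 0 ≤ δ ∧ δ ≤ 2 ∧
    ∀ Θ ∈ 𝒱, (Θs - Θ).PosSemidef ∧ specNorm (msqrt Θ * (msqrt Θs)⁻¹ - 1) ≤ δ

/-- The bordered matrix `[H, h; hᵀ, 0]`. -/
def bordered {d : ℕ} (h : Fin d → ℝ) (H : Matrix (Fin d) (Fin d) ℝ) :
    Matrix (Fin d ⊕ Unit) (Fin d ⊕ Unit) ℝ :=
  fromBlocks H (replicateCol Unit h) (replicateRow Unit h) 0

/-- The function `Υ(H, Θ)`. -/
def Upsilon {d : ℕ} (Θs : Matrix (Fin d) (Fin d) ℝ) (δ : ℝ)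
    (H Θ : Matrix (Fin d) (Fin d) ℝ) : ℝ :=
  -(1 / 2) * Real.log (1 - msqrt Θs * H * msqrt Θs).det
    + (1 / 2) * ((Θ - Θs) * H).trace
    + δ * (2 + δ) / (2 * (1 - specNorm (msqrt Θs * H * msqrt Θs)))
        * frobSq (msqrt Θs * H * msqrt Θs)

/-- The function `Γ(h, H; Z)`, for `Z` of size `d + 1`. -/
def Gam {d : ℕ} (Θs : Matrix (Fin d) (Fin d) ℝ)
    (h : Fin d → ℝ) (H : Matrix (Fin d) (Fin d) ℝ)
    (Z : Matrix (Fin d ⊕ Unit) (Fin d ⊕ Unit) ℝ) : ℝ :=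
  (1 / 2) * (Z * (bordered h H
    + (fromCols H (replicateCol Unit h))ᵀ * (Θs⁻¹ - H)⁻¹
        * fromCols H (replicateCol Unit h))).trace

/-- The function `Φ(h, H; Θ, Z) = Υ(H, Θ) + Γ(h, H; Z)`. -/
def Phi {d : ℕ} (Θs : Matrix (Fin d) (Fin d) ℝ) (δ : ℝ)
    (h : Fin d → ℝ) (H Θ : Matrix (Fin d) (Fin d) ℝ)
    (Z : Matrix (Fin d ⊕ Unit) (Fin d ⊕ Unit) ℝ) : ℝ :=
  Upsilon Θs δ H Θ + Gam Θs h H Z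

/-- The scales `α > 0` with `-γ α Θs⁻¹ ⪯ H ⪯ γ α Θs⁻¹`. -/
def scales {d : ℕ} (Θs : Matrix (Fin d) (Fin d) ℝ) (γ : ℝ)
    (H : Matrix (Fin d) (Fin d) ℝ) : Set ℝ :=
  {α | 0 < α ∧ (H + (γ * α) • Θs⁻¹).PosSemidef ∧ ((γ * α) • Θs⁻¹ - H).PosSemidef}

/-- `Ψ̂₊(h, H)` for sample size `K`. For nonempty compact `V`, `𝒵` as in the estimation problem and
`γ ∈ (0, 1)`, the set of scales is nonempty, and the infima and the supremum are finite. -/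
def psiPlus {m k d : ℕ} (V : Set (Fin k → ℝ))
    (M : (Fin k → ℝ) →ᵃ[ℝ] Matrix (Fin d) (Fin d) ℝ)
    (A : Matrix (Fin d) (Fin m ⊕ Unit) ℝ)
    (Q : Matrix (Fin m ⊕ Unit) (Fin m ⊕ Unit) ℝ) (q : Fin k → ℝ) (ε : ℝ)
    (𝒵 : Set (Matrix (Fin m ⊕ Unit) (Fin m ⊕ Unit) ℝ))
    (Θs : Matrix (Fin d) (Fin d) ℝ) (δ γ : ℝ) (K : ℕ)
    (h : Fin d → ℝ) (H : Matrix (Fin d) (Fin d) ℝ) : ℝ :=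
  ⨆ p : ↥(V ×ˢ 𝒵), ⨅ α : ↥(scales Θs γ H),
    ((α : ℝ) * Phi Θs δ ((α : ℝ)⁻¹ • h) ((α : ℝ)⁻¹ • H) (M p.1.1) (matB A * p.1.2 * (matB A)ᵀ)
      - functionalG Q q p.1.1 p.1.2 + (α : ℝ) / (K : ℝ) * Real.log (2 / ε))

/-- `Ψ̂₋(h, H)` for sample size `K`. -/
def psiMinus {m k d : ℕ} (V : Set (Fin k → ℝ))
    (M : (Fin k → ℝ) →ᵃ[ℝ] Matrix (Fin d) (Fin d) ℝ)
    (A : Matrix (Fin d) (Fin m ⊕ Unit) ℝ)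
    (Q : Matrix (Fin m ⊕ Unit) (Fin m ⊕ Unit) ℝ) (q : Fin k → ℝ) (ε : ℝ)
    (𝒵 : Set (Matrix (Fin m ⊕ Unit) (Fin m ⊕ Unit) ℝ))
    (Θs : Matrix (Fin d) (Fin d) ℝ) (δ γ : ℝ) (K : ℕ)
    (h : Fin d → ℝ) (H : Matrix (Fin d) (Fin d) ℝ) : ℝ :=
  ⨆ p : ↥(V ×ˢ 𝒵), ⨅ α : ↥(scales Θs γ H),
    ((α : ℝ) * Phi Θs δ (-((α : ℝ)⁻¹ • h)) (-((α : ℝ)⁻¹ • H)) (M p.1.1)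
        (matB A * p.1.2 * (matB A)ᵀ)
      + functionalG Q q p.1.1 p.1.2 + (α : ℝ) / (K : ℝ) * Real.log (2 / ε))

/-- The shift `ϰ_K = (Ψ̂₋ - Ψ̂₊) / 2`. -/
def kappa {m k d : ℕ} (V : Set (Fin k → ℝ))
    (M : (Fin k → ℝ) →ᵃ[ℝ] Matrix (Fin d) (Fin d) ℝ)
    (A : Matrix (Fin d) (Fin m ⊕ Unit) ℝ)
    (Q : Matrix (Fin m ⊕ Unit) (Fin m ⊕ Unit) ℝ) (q : Fin k → ℝ) (ε : ℝ)
    (𝒵 : Set (Matrix (Fin m ⊕ Unit) (Fin m ⊕ Unit) ℝ))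
    (Θs : Matrix (Fin d) (Fin d) ℝ) (δ γ : ℝ) (K : ℕ)
    (h : Fin d → ℝ) (H : Matrix (Fin d) (Fin d) ℝ) : ℝ :=
  (1 / 2) * (psiMinus V M A Q q ε 𝒵 Θs δ γ K h H - psiPlus V M A Q q ε 𝒵 Θs δ γ K h H)

/-- The estimate `ζ^K ↦ K⁻¹ ∑ᵢ [hᵀ ζᵢ + ½ ζᵢᵀ H ζᵢ] + ϰ`, affine in the quadratic lifts. -/
def estimate {d : ℕ} (K : ℕ) (h : Fin d → ℝ) (H : Matrix (Fin d) (Fin d) ℝ) (ϰ : ℝ)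
    (ζ : Fin K → EuclideanSpace ℝ (Fin d)) : ℝ :=
  (1 / (K : ℝ)) * ∑ i, (h ⬝ᵥ (ζ i).ofLp + (1 / 2) * ((ζ i).ofLp ⬝ᵥ (H *ᵥ (ζ i).ofLp))) + ϰ

/-- The law of one observation, `N(A [u; 1], M(v))`. -/
def obsLaw {m k d : ℕ} (M : (Fin k → ℝ) →ᵃ[ℝ] Matrix (Fin d) (Fin d) ℝ)
    (A : Matrix (Fin d) (Fin m ⊕ Unit) ℝ) (u : Fin m → ℝ) (v : Fin k → ℝ) :
    Measure (EuclideanSpace ℝ (Fin d)) :=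
  multivariateGaussian (WithLp.toLp 2 (A *ᵥ ext1 u)) (M v)

/-- The `ε`-risk of an estimate `g` based on `K` independent observations: the infimum of the
real `ρ` with `Prob {|g - F(u, v)| > ρ} ≤ ε` for all `(u, v) ∈ U × V`. It is `⊤` if there is no
such `ρ`. -/
def risk {m k d : ℕ} (U : Set (Fin m → ℝ)) (V : Set (Fin k → ℝ))
    (M : (Fin k → ℝ) →ᵃ[ℝ] Matrix (Fin d) (Fin d) ℝ)
    (A : Matrix (Fin d) (Fin m ⊕ Unit) ℝ)
    (Q : Matrix (Fin m ⊕ Unit) (Fin m ⊕ Unit) ℝ) (q : Fin k → ℝ) (ε : ℝ) (K : ℕ)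
    (g : (Fin K → EuclideanSpace ℝ (Fin d)) → ℝ) : EReal :=
  sInf ((fun ρ : ℝ => (ρ : EReal)) '' {ρ : ℝ | ∀ u ∈ U, ∀ v ∈ V,
    Measure.pi (fun _ : Fin K => obsLaw M A u v) {ζ | ρ < |g ζ - functionalF Q q u v|}
      ≤ ENNReal.ofReal ε})

/-- The matrix `Sᵒ`: `S` with its last diagonal entry replaced by zero. -/
def zeroCorner {d : ℕ} (S : Matrix (Fin d ⊕ Unit) (Fin d ⊕ Unit) ℝ) :
    Matrix (Fin d ⊕ Unit) (Fin d ⊕ Unit) ℝ :=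
  fromBlocks S.toBlocks₁₁ S.toBlocks₁₂ S.toBlocks₂₁ 0

/-- The vector `h̄` read off from `2 (Cᵀ Q C)ᵒ`. -/
def hBar {m d : ℕ} (C : Matrix (Fin m ⊕ Unit) (Fin d ⊕ Unit) ℝ)
    (Q : Matrix (Fin m ⊕ Unit) (Fin m ⊕ Unit) ℝ) : Fin d → ℝ :=
  fun i => 2 * zeroCorner (Cᵀ * Q * C) (Sum.inl i) (Sum.inr ())

/-- The matrix `H̄` read off from `2 (Cᵀ Q C)ᵒ`. -/
def HBar {m d : ℕ} (C : Matrix (Fin m ⊕ Unit) (Fin d ⊕ Unit) ℝ)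
    (Q : Matrix (Fin m ⊕ Unit) (Fin m ⊕ Unit) ℝ) : Matrix (Fin d) (Fin d) ℝ :=
  fun i j => 2 * zeroCorner (Cᵀ * Q * C) (Sum.inl i) (Sum.inl j)

/-- The defining relation `[H̄, h̄; h̄ᵀ, 0] = 2 (Cᵀ Q C)ᵒ`. -/
theorem bordered_bar {m d : ℕ} (C : Matrix (Fin m ⊕ Unit) (Fin d ⊕ Unit) ℝ)
    (Q : Matrix (Fin m ⊕ Unit) (Fin m ⊕ Unit) ℝ) (hQ : Q.IsSymm) :
    bordered (hBar C Q) (HBar C Q) = (2 : ℝ) • zeroCorner (Cᵀ * Q * C) := by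
  have hS : (Cᵀ * Q * C).IsSymm := by
    unfold Matrix.IsSymm
    rw [transpose_mul, transpose_mul, transpose_transpose, hQ.eq, Matrix.mul_assoc]
  ext i j
  rcases i with i | i <;> rcases j with j | j
  · simp [bordered, HBar]
  · simp [bordered, hBar]
  · simp only [bordered, hBar, zeroCorner, fromBlocks_apply₂₁, replicateRow_apply,
      fromBlocks_apply₁₂, toBlocks₁₂, toBlocks₂₁, of_apply, Matrix.smul_apply, smul_eq_mul]
    rw [← hS.apply]
  · simp [bordered, zeroCorner]

end QuadLift

end

open QuadLift

/-! The function Φ vanishes at the origin. In a direction (h, H) its derivative there is the linear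
form ½Tr(ΘH) + ½Tr(W[H,h;hᵀ,0]). On the admissible scales αΦ(h/α, H/α) lies above this form
(`le_mul_Phi_smul`), and as α → ∞ it tends to it, uniformly over W = BZBᵀ with Z in a compact set
(`eventually_mul_Phi_smul_le`).

Let c be the corner entry of CᵀQC. Since CB = I and Z has corner 1, the linear form at (h̄, H̄)
minus G(v̄, Z) is a constant L = ½Tr(M(v̄)H̄) - c - qᵀv̄, the same for every Z
(`half_trace_mul_bordered_bar`). A large fixed α makes the saddle value close to L, and its cost
(α/K)ln(2/ε) vanishes as K → ∞. Hence Ψ̂₊ → L, Ψ̂₋ → -L and ϰ_K → -L (`tendsto_saddle`,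
`tendsto_kappa`).

The same L is the bias of the unshifted estimate, for every u (`integral_quadFun`,
`quadFun_bar_mean`), so the shift removes the bias asymptotically. The variance of one summand is
bounded uniformly over the bounded set U, so Chebyshev's inequality gives uniform consistency and
the risk tends to 0. -/

namespace QuadLift

/-! ### Traces and the expansion of log det -/

section MatrixFacts

variable {n : Type*} [Fintype n] [DecidableEq n]

theorem trace_mul_nonneg_of_posSemidef {S T : Matrix n n ℝ} (hS : S.PosSemidef)
    (hT : T.PosSemidef) : 0 ≤ (S * T).trace := by
  open scoped MatrixOrder in
  obtain ⟨Y, rfl⟩ := CStarAlgebra.nonneg_iff_eq_star_mul_self.mp hS.nonneg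
  rw [star_eq_conjTranspose, Matrix.mul_assoc, Matrix.trace_mul_comm]
  exact (hT.mul_mul_conjTranspose_same Y).trace_nonneg

/-- Apply log x ≤ x - 1 to each eigenvalue. This tangent-line bound keeps the `log det` term of
`Upsilon` above its linear part. -/
theorem log_det_le_trace_sub_card {S : Matrix n n ℝ} (hS : S.PosDef) :
    Real.log S.det ≤ S.trace - Fintype.card n := by
  have hpos := hS.eigenvalues_pos
  rw [hS.1.det_eq_prod_eigenvalues, hS.1.trace_eq_sum_eigenvalues]
  simp only [RCLike.ofReal_real_eq_id, id_eq]
  rw [Real.log_prod (fun i _ => (hpos i).ne')]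
  calc ∑ i, Real.log (hS.1.eigenvalues i) ≤ ∑ i, (hS.1.eigenvalues i - 1) :=
        Finset.sum_le_sum fun i _ => Real.log_le_sub_one_of_pos (hpos i)
    _ = _ := by simp [Finset.sum_sub_distrib]

/-- The first order expansion of `log det` at the identity. -/
theorem tendsto_mul_log_det_one_sub (X : Matrix n n ℝ) :
    Tendsto (fun α : ℝ => α * Real.log (1 - α⁻¹ • X).det) atTop (𝓝 (-X.trace)) := by
  have hder : HasDerivAt (fun t : ℝ => (1 + t • (-X)).det) (-X.trace) 0 := by
    rw [funext fun t : ℝ => Matrix.det_one_add_smul t (-X)]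
    -- The determinant is 1 - t Tr X plus t² times a polynomial, and the last term has derivative
    -- zero at 0.
    have h1 := (((hasDerivAt_id (0 : ℝ)).const_mul (-X).trace).const_add 1).add
      (((1 + (Polynomial.X : Polynomial ℝ) • (-X).map Polynomial.C).det.divX.divX.hasDerivAt 0).mul
        (hasDerivAt_pow 2 (0 : ℝ)))
    exact h1.congr_deriv (by simp)
  have hlog : HasDerivAt (fun t : ℝ => Real.log (1 + t • (-X)).det) (-X.trace) 0 := by
    have := hder.log (by simp)
    simpa using this
  -- Since log det 1 = 0, the claim is the right-hand slope at 0, read along t = α⁻¹.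
  have hs := hlog.tendsto_slope_zero_right
  have hinv : Tendsto (fun α : ℝ => α⁻¹) atTop (𝓝[>] 0) := tendsto_inv_atTop_nhdsGT_zero
  have := hs.comp hinv
  refine this.congr fun α => ?_
  simp [sub_eq_add_neg]

end MatrixFacts

/-! ### Spectral norm, Loewner order and matrix square roots -/

section SpectralNorm

variable {d : ℕ}

theorem specNorm_le_of_posSemidef {X : Matrix (Fin d) (Fin d) ℝ} {c : ℝ} (hc : 0 < c)
    (h₁ : (X + c • 1).PosSemidef) (h₂ : (c • 1 - X).PosSemidef) : specNorm X ≤ c := by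
  have hXs : X.IsHermitian := by
    have := h₁.1.sub (Matrix.isHermitian_one.smul (k := c) (by simp [IsSelfAdjoint]))
    simpa using this
  -- The sum (c-X)(c+X)(c-X) + (c+X)(c-X)(c+X) equals 2c(c² - X²), and both summands are congruences
  -- of positive semidefinite matrices.
  have key : (c ^ 2 • (1 : Matrix (Fin d) (Fin d) ℝ) - X * X).PosSemidef := by
    have e₁ := h₁.mul_mul_conjTranspose_same (c • 1 - X)
    have e₂ := h₂.mul_mul_conjTranspose_same (X + c • 1)
    have e := (e₁.add e₂).smul (show (0 : ℝ) ≤ (2 * c)⁻¹ by positivity)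
    rw [h₁.1.eq, h₂.1.eq] at e
    convert e using 1
    have : (c • 1 - X) * (X + c • 1) * (c • 1 - X) + (X + c • 1) * (c • 1 - X) * (X + c • 1)
        = (2 * c) • (c ^ 2 • (1 : Matrix (Fin d) (Fin d) ℝ) - X * X) := by
      simp only [Matrix.sub_mul, Matrix.mul_sub, Matrix.add_mul, Matrix.mul_add, Matrix.smul_mul,
        Matrix.mul_smul, Matrix.one_mul, Matrix.mul_one]
      module
    rw [this, smul_smul, inv_mul_cancel₀ (by positivity), one_smul]
  refine ContinuousLinearMap.opNorm_le_bound _ hc.le fun v => ?_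
  refine le_of_sq_le_sq ?_ (by positivity)
  have hv := key.dotProduct_mulVec_nonneg v.ofLp
  rw [mul_pow, EuclideanSpace.real_norm_sq_eq, EuclideanSpace.real_norm_sq_eq]
  simp only [ofLp_toEuclideanCLM]
  have h1 : (X *ᵥ v.ofLp) ⬝ᵥ (X *ᵥ v.ofLp) = v.ofLp ⬝ᵥ ((X * X) *ᵥ v.ofLp) := by
    have hT : Xᵀ = X := by simpa using hXs.eq
    rw [← Matrix.mulVec_mulVec, Matrix.dotProduct_mulVec v.ofLp, ← Matrix.mulVec_transpose, hT]
  simp only [star_trivial, Matrix.sub_mulVec, Matrix.smul_mulVec, Matrix.one_mulVec,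
    dotProduct_sub, dotProduct_smul, smul_eq_mul, ← h1] at hv
  simp only [dotProduct, ← pow_two] at hv
  linarith

theorem specNorm_smul (t : ℝ) (X : Matrix (Fin d) (Fin d) ℝ) :
    specNorm (t • X) = |t| * specNorm X := by
  simp [specNorm, norm_smul]

theorem frobSq_smul (t : ℝ) (X : Matrix (Fin d) (Fin d) ℝ) :
    frobSq (t • X) = t ^ 2 * frobSq X := by
  simp [frobSq, mul_pow, Finset.mul_sum]

theorem frobSq_nonneg (X : Matrix (Fin d) (Fin d) ℝ) : 0 ≤ frobSq X :=
  Finset.sum_nonneg fun _ _ => Finset.sum_nonneg fun _ _ => sq_nonneg _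

theorem msqrt_posSemidef (S : Matrix (Fin d) (Fin d) ℝ) : (msqrt S).PosSemidef := by
  open scoped MatrixOrder in
  exact (CFC.sqrt_nonneg S).posSemidef

theorem msqrt_mul_self {S : Matrix (Fin d) (Fin d) ℝ} (hS : S.PosSemidef) :
    msqrt S * msqrt S = S := by
  open scoped MatrixOrder in
  exact CFC.sqrt_mul_sqrt_self _ hS.nonneg

theorem isUnit_det_msqrt {S : Matrix (Fin d) (Fin d) ℝ} (hS : S.PosDef) :
    IsUnit (msqrt S).det := by
  have h2 : (msqrt S).det * (msqrt S).det = S.det := by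
    rw [← det_mul, msqrt_mul_self hS.posSemidef]
  refine isUnit_iff_ne_zero.2 fun h0 => hS.det_pos.ne' ?_
  rw [← h2, h0, zero_mul]

theorem msqrt_mul_inv_mul_msqrt {S : Matrix (Fin d) (Fin d) ℝ} (hS : S.PosDef) :
    msqrt S * S⁻¹ * msqrt S = 1 := by
  have h := msqrt_mul_self hS.posSemidef
  have hu := isUnit_det_msqrt hS
  conv_lhs => rw [← h, Matrix.mul_inv_rev, h]
  rw [← Matrix.mul_assoc, Matrix.mul_nonsing_inv _ hu, Matrix.one_mul, Matrix.nonsing_inv_mul _ hu]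

theorem posSemidef_smul_one_sub {X : Matrix (Fin d) (Fin d) ℝ} (hX : X.IsHermitian) {t : ℝ}
    (ht : specNorm X ≤ t) : (t • 1 - X).PosSemidef := by
  refine .of_dotProduct_mulVec_nonneg
    ((Matrix.isHermitian_one.smul (by simp [IsSelfAdjoint])).sub hX) fun v => ?_
  have h1 := real_inner_le_norm (WithLp.toLp 2 v)
    (toEuclideanCLM (n := Fin d) (𝕜 := ℝ) X (WithLp.toLp 2 v))
  rw [inner_toEuclideanCLM] at h1
  have h2 := (toEuclideanCLM (n := Fin d) (𝕜 := ℝ) X).le_opNorm (WithLp.toLp 2 v)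
  have h3 : ‖WithLp.toLp 2 v‖ ^ 2 = v ⬝ᵥ v := by
    rw [EuclideanSpace.real_norm_sq_eq]; simp [dotProduct, pow_two]
  have h4 : v ⬝ᵥ X *ᵥ v ≤ t * (v ⬝ᵥ v) := by
    rw [← h3]
    calc v ⬝ᵥ X *ᵥ v ≤ _ := h1
      _ ≤ ‖WithLp.toLp 2 v‖ * (specNorm X * ‖WithLp.toLp 2 v‖) := by gcongr; exact h2
      _ ≤ ‖WithLp.toLp 2 v‖ * (t * ‖WithLp.toLp 2 v‖) := by gcongr
      _ = _ := by ring
  simp only [star_trivial, Matrix.sub_mulVec, Matrix.smul_mulVec, Matrix.one_mulVec,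
    dotProduct_sub, dotProduct_smul, smul_eq_mul]
  linarith

theorem msqrt_conj_smul_inv_sub {S : Matrix (Fin d) (Fin d) ℝ} (hS : S.PosDef)
    (H : Matrix (Fin d) (Fin d) ℝ) (t : ℝ) :
    msqrt S * (t • S⁻¹ - H) * msqrt S = t • 1 - msqrt S * H * msqrt S := by
  rw [Matrix.mul_sub, Matrix.sub_mul, Matrix.mul_smul, Matrix.smul_mul, msqrt_mul_inv_mul_msqrt hS]

/-- Congruence by the invertible square root of S turns S⁻¹ into the identity, so order bounds
against S⁻¹ become spectral norm bounds. -/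
theorem posSemidef_smul_inv_sub_iff {S : Matrix (Fin d) (Fin d) ℝ} (hS : S.PosDef)
    (H : Matrix (Fin d) (Fin d) ℝ) (t : ℝ) :
    (t • S⁻¹ - H).PosSemidef ↔ (t • 1 - msqrt S * H * msqrt S).PosSemidef := by
  have hu : IsUnit (msqrt S) := (Matrix.isUnit_iff_isUnit_det _).2 (isUnit_det_msqrt hS)
  rw [← hu.posSemidef_star_left_conjugate_iff, star_eq_conjTranspose,
    (msqrt_posSemidef S).1.eq, msqrt_conj_smul_inv_sub hS]

end SpectralNorm

/-! ### Admissible scales -/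

section Scales

variable {d : ℕ} {Θs H : Matrix (Fin d) (Fin d) ℝ} {γ : ℝ}

/-- This lets Ψ̂₋ be treated as the same saddle value at (-h, -H). -/
theorem scales_neg : scales Θs γ (-H) = scales Θs γ H := by
  ext α
  simp only [scales, Set.mem_ofPred_eq, sub_neg_eq_add, neg_add_eq_sub]
  rw [add_comm H]
  tauto

theorem eventually_mem_scales (hΘ : Θs.PosDef) (hH : H.IsSymm) (hγ : 0 < γ) :
    ∀ᶠ α in atTop, α ∈ scales Θs γ H := by
  have hX : (msqrt Θs * H * msqrt Θs).IsHermitian := by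
    have := Matrix.isHermitian_conjTranspose_mul_mul (msqrt Θs) (A := H) (by simpa using hH)
    rwa [(msqrt_posSemidef Θs).1.eq] at this
  filter_upwards [eventually_gt_atTop 0,
    eventually_ge_atTop (γ⁻¹ * specNorm (msqrt Θs * H * msqrt Θs))] with α h0 hα
  have hα' : specNorm (msqrt Θs * H * msqrt Θs) ≤ γ * α := by
    rwa [inv_mul_le_iff₀ hγ] at hα
  refine ⟨h0, ?_, ?_⟩
  · rw [add_comm, ← sub_neg_eq_add, posSemidef_smul_inv_sub_iff hΘ]
    refine posSemidef_smul_one_sub (by simpa using hX.neg) ?_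
    simpa [specNorm] using hα'
  · rw [posSemidef_smul_inv_sub_iff hΘ]
    exact posSemidef_smul_one_sub hX hα'

theorem specNorm_msqrt_conj_le (hΘ : Θs.PosDef) (hγ : 0 < γ) {α : ℝ} (hα : α ∈ scales Θs γ H) :
    specNorm (msqrt Θs * H * msqrt Θs) ≤ γ * α := by
  obtain ⟨h0, h1, h2⟩ := hα
  rw [posSemidef_smul_inv_sub_iff hΘ] at h2
  rw [add_comm, ← sub_neg_eq_add, posSemidef_smul_inv_sub_iff hΘ] at h1
  refine specNorm_le_of_posSemidef (by positivity) ?_ h2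
  convert h1 using 1
  simp [add_comm]

/-- Inside the scales, the rescaled argument of `log det` is positive definite. -/
theorem posDef_one_sub_of_mem_scales (hΘ : Θs.PosDef) (hγ1 : γ < 1) {α : ℝ}
    (hα : α ∈ scales Θs γ H) : (1 - α⁻¹ • (msqrt Θs * H * msqrt Θs)).PosDef := by
  obtain ⟨h0, -, h2⟩ := hα
  rw [posSemidef_smul_inv_sub_iff hΘ] at h2
  have h3 := h2.smul (inv_nonneg.2 h0.le)
  -- The strictly positive part (1-γ)I is split off; this is where γ < 1 enters.
  have h4 := (Matrix.PosDef.one (n := Fin d) (R := ℝ)).smul (sub_pos.2 hγ1)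
  have h5 := h4.add_posSemidef h3
  rw [smul_sub, smul_smul, show α⁻¹ * (γ * α) = γ by field_simp] at h5
  have e : (1 : Matrix (Fin d) (Fin d) ℝ) - α⁻¹ • (msqrt Θs * H * msqrt Θs)
      = (1 - γ) • 1 + (γ • 1 - α⁻¹ • (msqrt Θs * H * msqrt Θs)) := by module
  rwa [e]

theorem posDef_inv_sub_of_mem_scales (hΘ : Θs.PosDef) (hγ1 : γ < 1) {α : ℝ}
    (hα : α ∈ scales Θs γ H) : (Θs⁻¹ - α⁻¹ • H).PosDef := by
  obtain ⟨h0, -, h2⟩ := hα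
  have h3 := h2.smul (inv_nonneg.2 h0.le)
  have h5 := (hΘ.inv.smul (sub_pos.2 hγ1)).add_posSemidef h3
  rw [smul_sub, smul_smul, show α⁻¹ * (γ * α) = γ by field_simp] at h5
  have e : Θs⁻¹ - α⁻¹ • H = (1 - γ) • Θs⁻¹ + (γ • Θs⁻¹ - α⁻¹ • H) := by module
  rwa [e]

end Scales

/-- The added cost is nonnegative, so the lower bound L survives the infimum and the supremum. For
the upper bound one scale α serves all p at once, and for that fixed α the cost tends to 0 with K.
-/
theorem tendsto_iSup_iInf_of_squeeze {P : Type*} [Nonempty P] {S : Set ℝ} (hS : S.Nonempty)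
    (hS0 : ∀ α ∈ S, 0 < α) {E : ℝ → P → ℝ} {L ℓ : ℝ} (hℓ : 0 ≤ ℓ)
    (hlow : ∀ α ∈ S, ∀ p, L ≤ E α p)
    (hup : ∀ η > 0, ∃ α ∈ S, ∀ p, E α p ≤ L + η) :
    Tendsto (fun K : ℕ => ⨆ p, ⨅ α : S, (E α p + α / (K : ℝ) * ℓ)) atTop (𝓝 L) := by
  have : Nonempty S := hS.to_subtype
  have hge : ∀ (K : ℕ) (p : P) (α : S), L ≤ E α p + α / (K : ℝ) * ℓ := fun K p α => by
    have h1 := hlow α α.2 p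
    have h2 : 0 ≤ (α : ℝ) / (K : ℝ) * ℓ :=
      mul_nonneg (div_nonneg (hS0 α α.2).le (Nat.cast_nonneg K)) hℓ
    linarith
  have hbdd : ∀ (K : ℕ) (p : P), BddBelow (Set.range fun α : S => E α p + α / (K : ℝ) * ℓ) :=
    fun K p => ⟨L, by rintro _ ⟨α, rfl⟩; exact hge K p α⟩
  have hle : ∀ (K : ℕ) (α : S) (η : ℝ), (∀ p, E α p ≤ L + η) → ∀ p,
      ⨅ α : S, (E α p + α / (K : ℝ) * ℓ) ≤ L + η + α / (K : ℝ) * ℓ := fun K α η h p =>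
    (ciInf_le (hbdd K p) α).trans (by simpa using h p)
  -- This crude choice only shows that the real supremum is over a set bounded above.
  obtain ⟨α₁, hα₁, h₁⟩ := hup 1 one_pos
  have hlowK : ∀ K : ℕ, L ≤ ⨆ p, ⨅ α : S, (E α p + α / (K : ℝ) * ℓ) := fun K => by
    obtain ⟨p⟩ := ‹Nonempty P›
    refine (le_ciInf (hge K p)).trans (le_ciSup (f := fun p => ⨅ α : S, (E α p + α / (K : ℝ) * ℓ)) ?_ p)
    exact ⟨_, by rintro _ ⟨p, rfl⟩; exact hle K ⟨α₁, hα₁⟩ 1 h₁ p⟩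
  rw [Metric.tendsto_atTop']
  intro η hη
  obtain ⟨α, hα, h⟩ := hup (η / 2) (half_pos hη)
  have hlim : Tendsto (fun K : ℕ => α / (K : ℝ) * ℓ) atTop (𝓝 0) := by
    simpa using (tendsto_const_div_atTop_nhds_zero_nat α).mul_const ℓ
  obtain ⟨N, hN⟩ := (hlim.eventually (gt_mem_nhds (half_pos hη))).exists_forall_of_atTop
  refine ⟨N, fun K hK => ?_⟩
  have h1 : ⨆ p, ⨅ α : S, (E α p + α / (K : ℝ) * ℓ) ≤ L + η / 2 + α / (K : ℝ) * ℓ :=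
    ciSup_le (hle K ⟨α, hα⟩ _ h)
  rw [Real.dist_eq, abs_of_nonneg (sub_nonneg.2 (hlowK K))]
  linarith [hN K hK.le]

/-! ### The behaviour of αΦ(h/α, H/α) -/

section Bounds

variable {d : ℕ} {Θs H : Matrix (Fin d) (Fin d) ℝ} {γ δ : ℝ} {h : Fin d → ℝ}

/-- The second order part of `Γ`, at the scale `α`. -/
noncomputable def curvature (Θs : Matrix (Fin d) (Fin d) ℝ) (h : Fin d → ℝ) (H : Matrix (Fin d) (Fin d) ℝ)
    (α : ℝ) : Matrix (Fin d ⊕ Unit) (Fin d ⊕ Unit) ℝ :=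
  (fromCols H (replicateCol Unit h))ᵀ * (Θs⁻¹ - α⁻¹ • H)⁻¹ * fromCols H (replicateCol Unit h)

theorem bordered_smul (t : ℝ) : bordered (t • h) (t • H) = t • bordered h H := by
  ext i j
  rcases i with i | i <;> rcases j with j | j <;> simp [bordered]

theorem fromCols_smul (t : ℝ) : fromCols (t • H) (replicateCol Unit (t • h))
    = t • fromCols H (replicateCol Unit h) := by
  ext i j
  rcases j with j | j <;> simp

/-- Rescaling fixes the linear part of `Gam` and leaves a factor α⁻¹ on the quadratic part. -/
theorem mul_Gam_smul {α : ℝ} (hα : 0 < α) (W : Matrix (Fin d ⊕ Unit) (Fin d ⊕ Unit) ℝ) :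
    α * Gam Θs (α⁻¹ • h) (α⁻¹ • H) W
      = (1 / 2) * (W * bordered h H).trace + α⁻¹ * ((1 / 2) * (W * curvature Θs h H α).trace) := by
  rw [Gam, bordered_smul, fromCols_smul, curvature]
  simp only [transpose_smul, Matrix.smul_mul, Matrix.mul_smul, Matrix.mul_add, Matrix.trace_add,
    Matrix.trace_smul, smul_eq_mul]
  field_simp

/-- The penalty term of `Υ`, at the scale `α`. -/
noncomputable def penalty (Θs : Matrix (Fin d) (Fin d) ℝ) (δ : ℝ) (H : Matrix (Fin d) (Fin d) ℝ) (α : ℝ) : ℝ :=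
  α⁻¹ * (δ * (2 + δ) / (2 * (1 - |α⁻¹| * specNorm (msqrt Θs * H * msqrt Θs)))
        * frobSq (msqrt Θs * H * msqrt Θs))

theorem mul_Upsilon_smul {α : ℝ} (hα : 0 < α) (Θ : Matrix (Fin d) (Fin d) ℝ) :
    α * Upsilon Θs δ (α⁻¹ • H) Θ
      = -(1 / 2) * (α * Real.log (1 - α⁻¹ • (msqrt Θs * H * msqrt Θs)).det)
        + (1 / 2) * ((Θ - Θs) * H).trace + penalty Θs δ H α := by
  rw [Upsilon, penalty]
  simp only [Matrix.mul_smul, Matrix.smul_mul, specNorm_smul, frobSq_smul, Matrix.trace_smul,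
    smul_eq_mul]
  field_simp

theorem trace_msqrt_conj (hΘ : Θs.PosDef) :
    (msqrt Θs * H * msqrt Θs).trace = (Θs * H).trace := by
  rw [Matrix.trace_mul_comm, ← Matrix.mul_assoc, msqrt_mul_self hΘ.posSemidef]

theorem penalty_nonneg (hΘ : Θs.PosDef) (hγ0 : 0 < γ) (hγ1 : γ < 1) (hδ : 0 ≤ δ) {α : ℝ}
    (hα : α ∈ scales Θs γ H) : 0 ≤ penalty Θs δ H α := by
  have h0 := hα.1
  have h1 := specNorm_msqrt_conj_le hΘ hγ0 hα
  have h2 : |α⁻¹| * specNorm (msqrt Θs * H * msqrt Θs) ≤ γ := by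
    rw [abs_of_pos (inv_pos.2 h0), inv_mul_le_iff₀ h0, mul_comm]
    exact h1
  have h3 := frobSq_nonneg (msqrt Θs * H * msqrt Θs)
  have h4 : 0 ≤ 1 - |α⁻¹| * specNorm (msqrt Θs * H * msqrt Θs) := by linarith
  unfold penalty
  positivity

theorem curvature_posSemidef (hΘ : Θs.PosDef) (hγ1 : γ < 1) {α : ℝ} (hα : α ∈ scales Θs γ H) :
    (curvature Θs h H α).PosSemidef := by
  have := (posDef_inv_sub_of_mem_scales hΘ hγ1 hα).inv.posSemidef.conjTranspose_mul_mul_same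
    (fromCols H (replicateCol Unit h))
  rwa [conjTranspose_eq_transpose_of_trivial] at this

/-- `α Φ(h/α, H/α)` dominates the derivative of `Φ` at the origin. -/
theorem le_mul_Phi_smul (hΘ : Θs.PosDef) (hγ0 : 0 < γ) (hγ1 : γ < 1) (hδ : 0 ≤ δ) {α : ℝ}
    (hα : α ∈ scales Θs γ H) (Θ : Matrix (Fin d) (Fin d) ℝ)
    {W : Matrix (Fin d ⊕ Unit) (Fin d ⊕ Unit) ℝ} (hW : W.PosSemidef) :
    (1 / 2) * (Θ * H).trace + (1 / 2) * (W * bordered h H).trace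
      ≤ α * Phi Θs δ (α⁻¹ • h) (α⁻¹ • H) Θ W := by
  have h0 := hα.1
  rw [Phi, mul_add, mul_Gam_smul h0, mul_Upsilon_smul h0]
  have h1 := log_det_le_trace_sub_card (posDef_one_sub_of_mem_scales hΘ hγ1 hα)
  rw [Matrix.trace_sub, Matrix.trace_one, Matrix.trace_smul, trace_msqrt_conj hΘ, smul_eq_mul] at h1
  have h2 := mul_le_mul_of_nonneg_left h1 h0.le
  -- The dimension cancels. What remains contributes ½Tr(ΘsH), which offsets the -½Tr(ΘsH) in
  -- `Upsilon` and leaves ½Tr(ΘH).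
  have h3 : α * ((Fintype.card (Fin d) : ℝ) - α⁻¹ * (Θs * H).trace - Fintype.card (Fin d))
      = -(Θs * H).trace := by field_simp; ring
  rw [h3] at h2
  have h4 := penalty_nonneg hΘ hγ0 hγ1 hδ hα
  have h5 : 0 ≤ α⁻¹ * ((1 / 2) * (W * curvature Θs h H α).trace) := by
    have := trace_mul_nonneg_of_posSemidef hW (curvature_posSemidef (h := h) hΘ hγ1 hα)
    positivity
  rw [Matrix.sub_mul, Matrix.trace_sub]
  linarith

theorem tendsto_penalty : Tendsto (penalty Θs δ H) atTop (𝓝 0) := by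
  have hi : Tendsto (fun α : ℝ => α⁻¹) atTop (𝓝 0) := tendsto_inv_atTop_zero
  have h1 : Tendsto (fun α : ℝ => 2 * (1 - |α⁻¹| * specNorm (msqrt Θs * H * msqrt Θs))) atTop
      (𝓝 (2 * (1 - |0| * specNorm (msqrt Θs * H * msqrt Θs)))) :=
    ((hi.abs.mul_const _).const_sub 1).const_mul 2
  have h2 : Tendsto (penalty Θs δ H) atTop (𝓝 (0 * _)) := hi.mul (((tendsto_const_nhds (x := δ * (2 + δ))).div h1 (by simp)).mul_const
    (frobSq (msqrt Θs * H * msqrt Θs)))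
  rwa [zero_mul] at h2

theorem tendsto_curvature (hΘ : Θs.PosDef) :
    Tendsto (curvature Θs h H) atTop
      (𝓝 ((fromCols H (replicateCol Unit h))ᵀ * Θs * fromCols H (replicateCol Unit h))) := by
  have hi : Tendsto (fun α : ℝ => Θs⁻¹ - α⁻¹ • H) atTop (𝓝 Θs⁻¹) := by
    simpa using (tendsto_inv_atTop_zero (𝕜 := ℝ)).smul_const H |>.const_sub Θs⁻¹
  have hc : ContinuousAt Inv.inv (Θs⁻¹) :=
    continuousAt_matrix_inv _ (by
      have := hΘ.inv.det_pos.ne'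
      simpa [Ring.inverse_eq_inv'] using continuousAt_inv₀ this)
  have h1 := hc.tendsto.comp hi
  rw [Matrix.nonsing_inv_nonsing_inv _ (isUnit_iff_ne_zero.2 hΘ.det_pos.ne')] at h1
  have hcont : Continuous fun N : Matrix (Fin d) (Fin d) ℝ =>
      (fromCols H (replicateCol Unit h))ᵀ * N * fromCols H (replicateCol Unit h) := by fun_prop
  exact (hcont.tendsto _).comp h1

theorem abs_trace_mul_le {n : Type*} [Fintype n] {c : ℝ} {Z : Matrix n n ℝ}
    (hZ : ∀ i j, |Z i j| ≤ c) (N : Matrix n n ℝ) :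
    |(Z * N).trace| ≤ c * ∑ i, ∑ j, |N j i| := by
  rw [Finset.mul_sum]
  refine (Finset.abs_sum_le_sum_abs _ _).trans (Finset.sum_le_sum fun i _ => ?_)
  rw [Matrix.diag_apply, Matrix.mul_apply, Finset.mul_sum]
  refine (Finset.abs_sum_le_sum_abs _ _).trans (Finset.sum_le_sum fun j _ => ?_)
  rw [abs_mul]
  exact mul_le_mul_of_nonneg_right (hZ i j) (abs_nonneg _)

theorem exists_entry_bound {n : Type*} [Finite n] {𝒵 : Set (Matrix n n ℝ)} (h𝒵 : IsCompact 𝒵) :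
    ∃ c : ℝ, ∀ Z ∈ 𝒵, ∀ i j, |Z i j| ≤ c := by
  have := Fintype.ofFinite n
  obtain ⟨c, hc⟩ := h𝒵.exists_bound_of_continuousOn (f := fun Z => ∑ i, ∑ j, |Z i j|)
    (by fun_prop)
  refine ⟨c, fun Z hZ i j => le_trans ?_ ((le_abs_self _).trans (hc Z hZ))⟩
  refine le_trans ?_ (Finset.single_le_sum (f := fun i => ∑ j, |Z i j|)
    (fun _ _ => Finset.sum_nonneg fun _ _ => abs_nonneg _) (Finset.mem_univ i))
  exact Finset.single_le_sum (f := fun j => |Z i j|) (fun _ _ => abs_nonneg _) (Finset.mem_univ j)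

/-- As `α → ∞`, `α Φ(h/α, H/α)` approaches the derivative of `Φ` at the origin, uniformly
over a compact set of second moment matrices. -/
theorem eventually_mul_Phi_smul_le {m : Type*} [Fintype m] [DecidableEq m]
    {𝒵 : Set (Matrix m m ℝ)} (h𝒵 : IsCompact 𝒵) (hΘ : Θs.PosDef)
    (B : Matrix (Fin d ⊕ Unit) m ℝ) (Θ : Matrix (Fin d) (Fin d) ℝ) {η : ℝ} (hη : 0 < η) :
    ∀ᶠ α : ℝ in atTop, ∀ Z ∈ 𝒵, α * Phi Θs δ (α⁻¹ • h) (α⁻¹ • H) Θ (B * Z * Bᵀ)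
      ≤ (1 / 2) * (Θ * H).trace + (1 / 2) * (B * Z * Bᵀ * bordered h H).trace + η := by
  obtain ⟨c, hc⟩ := exists_entry_bound h𝒵
  -- This majorant of the curvature term does not involve Z, which gives uniformity over the compact
  -- set.
  have hN : Tendsto (fun α => α⁻¹ * ((1 / 2) *
      (c * ∑ i, ∑ j, |(Bᵀ * curvature Θs h H α * B) j i|))) atTop (𝓝 0) := by
    have hcont : Continuous fun N : Matrix (Fin d ⊕ Unit) (Fin d ⊕ Unit) ℝ =>
        (1 / 2) * (c * ∑ i, ∑ j, |(Bᵀ * N * B) j i|) := by fun_prop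
    simpa using tendsto_inv_atTop_zero.mul
      ((hcont.tendsto _).comp (tendsto_curvature (h := h) (H := H) hΘ))
  have hlog := (tendsto_mul_log_det_one_sub (msqrt Θs * H * msqrt Θs)).const_mul (-(1 / 2))
  have hsum := (hlog.add (tendsto_penalty (Θs := Θs) (δ := δ) (H := H))).add hN
  filter_upwards [eventually_gt_atTop 0, hsum.eventually (gt_mem_nhds (lt_add_of_pos_right _ hη))]
    with α h0 hα Z hZ
  rw [Phi, mul_add, mul_Gam_smul h0, mul_Upsilon_smul h0]
  have h1 : (B * Z * Bᵀ * curvature Θs h H α).trace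
      ≤ c * ∑ i, ∑ j, |(Bᵀ * curvature Θs h H α * B) j i| := by
    rw [Matrix.mul_assoc, Matrix.mul_assoc, Matrix.trace_mul_comm, Matrix.mul_assoc]
    exact (le_abs_self _).trans (abs_trace_mul_le (hc Z hZ) _)
  have h2 : α⁻¹ * ((1 / 2) * (B * Z * Bᵀ * curvature Θs h H α).trace) ≤ _ :=
    mul_le_mul_of_nonneg_left (mul_le_mul_of_nonneg_left h1 (by norm_num)) (inv_pos.2 h0).le
  rw [trace_msqrt_conj hΘ] at hα
  rw [Matrix.sub_mul, Matrix.trace_sub]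
  linarith

end Bounds

/-- If the derivative of `Φ` at the origin balances `c` on the compact set `𝒵`, the saddle value
converges to the common value. -/
theorem tendsto_saddle {k d : ℕ} {m : Type*} [Fintype m] [DecidableEq m]
    {𝒵 : Set (Matrix m m ℝ)} (h𝒵 : IsCompact 𝒵) (hne : 𝒵.Nonempty)
    (hpos : ∀ Z ∈ 𝒵, Z.PosSemidef) (v : Fin k → ℝ)
    (M : (Fin k → ℝ) →ᵃ[ℝ] Matrix (Fin d) (Fin d) ℝ)
    {Θs H : Matrix (Fin d) (Fin d) ℝ} {γ δ ℓ L : ℝ} {h : Fin d → ℝ} (hΘ : Θs.PosDef)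
    (hγ0 : 0 < γ) (hγ1 : γ < 1) (hδ : 0 ≤ δ) (hℓ : 0 ≤ ℓ) (hH : H.IsSymm)
    (B : Matrix (Fin d ⊕ Unit) m ℝ) (c : (Fin k → ℝ) × Matrix m m ℝ → ℝ)
    (hc : ∀ Z ∈ 𝒵, (1 / 2) * (M v * H).trace + (1 / 2) * (B * Z * Bᵀ * bordered h H).trace
      + c (v, Z) = L) :
    Tendsto (fun K : ℕ => ⨆ p : ↥(({v} : Set (Fin k → ℝ)) ×ˢ 𝒵), ⨅ α : ↥(scales Θs γ H),
      ((α : ℝ) * Phi Θs δ ((α : ℝ)⁻¹ • h) ((α : ℝ)⁻¹ • H) (M p.1.1) (B * p.1.2 * Bᵀ)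
        + c p.1 + (α : ℝ) / (K : ℝ) * ℓ)) atTop (𝓝 L) := by
  have : Nonempty ↥(({v} : Set (Fin k → ℝ)) ×ˢ 𝒵) :=
    ((Set.singleton_nonempty v).prod hne).to_subtype
  have hsc := eventually_mem_scales hΘ hH hγ0
  refine tendsto_iSup_iInf_of_squeeze
    (E := fun α (p : ↥(({v} : Set (Fin k → ℝ)) ×ˢ 𝒵)) =>
      α * Phi Θs δ (α⁻¹ • h) (α⁻¹ • H) (M p.1.1) (B * p.1.2 * Bᵀ) + c p.1)
    hsc.exists (fun α hα => hα.1) hℓ ?_ ?_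
  · rintro α hα ⟨⟨w, Z⟩, hw, hZ⟩
    obtain rfl : w = v := hw
    have hW : (B * Z * Bᵀ).PosSemidef := by
      have := (hpos Z hZ).mul_mul_conjTranspose_same B
      rwa [conjTranspose_eq_transpose_of_trivial] at this
    have := le_mul_Phi_smul (h := h) hΘ hγ0 hγ1 hδ hα (M w) hW
    linarith [hc Z hZ]
  · intro η hη
    obtain ⟨α, hα, hle⟩ := (hsc.and
      (eventually_mul_Phi_smul_le (δ := δ) (h := h) (H := H) h𝒵 hΘ B (M v) hη)).exists
    refine ⟨α, hα, ?_⟩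
    rintro ⟨⟨w, Z⟩, hw, hZ⟩
    obtain rfl : w = v := hw
    have := hle Z hZ
    linarith [hc Z hZ]

/-! ### Chebyshev's inequality for sample averages -/

section Chebyshev

/-- A bound V replaces the variance itself, so that one estimate covers a whole family of laws. -/
theorem measure_pi_average_deviation_le {Ω : Type*} [MeasurableSpace Ω] {μ : Measure Ω}
    [IsProbabilityMeasure μ] {f : Ω → ℝ} (hf : MemLp f 2 μ) {V η : ℝ} (hV : Var[f; μ] ≤ V)
    (hη : 0 < η) {K : ℕ} (hK : 0 < K) :
    Measure.pi (fun _ : Fin K => μ) {ζ | η ≤ |1 / (K : ℝ) * ∑ i, f (ζ i) - μ[f]|}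
      ≤ ENNReal.ofReal (V / η ^ 2 / K) := by
  have hK' : (0 : ℝ) < K := by exact_mod_cast hK
  have hcomp : ∀ i : Fin K, MemLp (fun ζ : Fin K → Ω => f (ζ i)) 2 (Measure.pi fun _ => μ) :=
    fun i => hf.comp_measurePreserving (measurePreserving_eval (fun _ : Fin K => μ) i)
  have hsum : MemLp (fun ζ : Fin K → Ω => 1 / (K : ℝ) * ∑ i, f (ζ i)) 2 (Measure.pi fun _ => μ) :=
    (memLp_finsetSum _ fun i _ => hcomp i).const_mul _
  have hvar : Var[fun ζ : Fin K → Ω => 1 / (K : ℝ) * ∑ i, f (ζ i); Measure.pi fun _ => μ]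
      = Var[f; μ] / K := by
    rw [variance_const_mul]
    have h := variance_sum_pi (μ := fun _ : Fin K => μ) (X := fun _ => f) fun _ => hf
    rw [show (fun ζ : Fin K → Ω => ∑ i, f (ζ i)) = ∑ i, fun ζ : Fin K → Ω => f (ζ i) by
      ext; simp, h]
    simp
    field_simp
  have hmean : (Measure.pi fun _ : Fin K => μ)[fun ζ => 1 / (K : ℝ) * ∑ i, f (ζ i)] = μ[f] := by
    rw [integral_const_mul, integral_finsetSum _ fun i _ => (hcomp i).integrable (by norm_num)]
    have : ∀ i : Fin K, ∫ ζ : Fin K → Ω, f (ζ i) ∂(Measure.pi fun _ => μ) = μ[f] := fun i => by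
      have h := measurePreserving_eval (fun _ : Fin K => μ) i
      have := integral_map (μ := Measure.pi fun _ : Fin K => μ) h.aemeasurable (f := f)
        (by rw [h.map_eq]; exact hf.1)
      rw [h.map_eq] at this
      exact this.symm
    simp_rw [this]
    simp
    field_simp
  have h := meas_ge_le_variance_div_sq hsum hη
  rw [hmean, hvar] at h
  refine h.trans (ENNReal.ofReal_le_ofReal ?_)
  rw [div_right_comm]
  gcongr

end Chebyshev

/-! ### Gaussian moments of quadratic functions -/

section Gaussian

variable {d : ℕ}

/-- The quadratic function `x ↦ hᵀ x + ½ xᵀ H x`. -/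
noncomputable def quadFun (h : Fin d → ℝ) (H : Matrix (Fin d) (Fin d) ℝ)
    (x : EuclideanSpace ℝ (Fin d)) : ℝ :=
  h ⬝ᵥ x.ofLp + (1 / 2) * (x.ofLp ⬝ᵥ (H *ᵥ x.ofLp))

theorem continuous_quadFun (h : Fin d → ℝ) (H : Matrix (Fin d) (Fin d) ℝ) :
    Continuous (quadFun h H) := by
  unfold quadFun
  fun_prop

theorem abs_quadFun_le (h : Fin d → ℝ) (H : Matrix (Fin d) (Fin d) ℝ)
    (x : EuclideanSpace ℝ (Fin d)) :
    |quadFun h H x| ≤ (‖WithLp.toLp 2 h‖ + specNorm H) * (1 + ‖x‖ ^ 2) := by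
  have h1 := abs_real_inner_le_norm (WithLp.toLp 2 h) x
  have h2 := abs_real_inner_le_norm x (toEuclideanCLM (n := Fin d) (𝕜 := ℝ) H x)
  have h3 := (toEuclideanCLM (n := Fin d) (𝕜 := ℝ) H).le_opNorm x
  rw [inner_toEuclideanCLM] at h2
  have h4 : inner ℝ (WithLp.toLp 2 h) x = h ⬝ᵥ x.ofLp := by
    rw [EuclideanSpace.inner_eq_star_dotProduct, dotProduct_comm]; simp
  rw [h4] at h1
  have h5 : |x.ofLp ⬝ᵥ H *ᵥ x.ofLp| ≤ specNorm H * ‖x‖ ^ 2 :=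
    h2.trans ((mul_le_mul_of_nonneg_left h3 (norm_nonneg x)).trans_eq (by rw [specNorm]; ring))
  have h6 : 0 ≤ specNorm H := norm_nonneg _
  have h7 : ‖x‖ ≤ 1 + ‖x‖ ^ 2 := by nlinarith [sq_nonneg (‖x‖ - 1), norm_nonneg x]
  have h8 := mul_le_mul_of_nonneg_left h7 (norm_nonneg (WithLp.toLp 2 h))
  have h9 := abs_add_le (h ⬝ᵥ x.ofLp) ((1 / 2) * (x.ofLp ⬝ᵥ (H *ᵥ x.ofLp)))
  rw [abs_mul, abs_of_pos (by norm_num : (0 : ℝ) < 1 / 2)] at h9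
  have h10 : 0 ≤ specNorm H * ‖x‖ ^ 2 := by positivity
  rw [quadFun]
  linarith

theorem memLp_one_add_norm_sq (ν : Measure (EuclideanSpace ℝ (Fin d))) [IsGaussian ν] :
    MemLp (fun x => 1 + ‖x‖ ^ 2) 2 ν := by
  have h0 : MemLp (fun x : EuclideanSpace ℝ (Fin d) => x) ((4 : ℕ) : ENNReal) ν :=
    IsGaussian.memLp_id ν _ (ENNReal.natCast_ne_top 4)
  have h4 : Integrable (fun x : EuclideanSpace ℝ (Fin d) => ‖x‖ ^ 4) ν :=
    h0.integrable_norm_pow (by norm_num)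
  have : MemLp (fun x : EuclideanSpace ℝ (Fin d) => ‖x‖ ^ 2) 2 ν := by
    refine (memLp_two_iff_integrable_sq (by fun_prop)).2 (h4.congr ?_)
    filter_upwards with x
    ring
  exact (memLp_const (1 : ℝ)).add this

theorem memLp_quadFun (ν : Measure (EuclideanSpace ℝ (Fin d))) [IsGaussian ν] (h : Fin d → ℝ)
    (H : Matrix (Fin d) (Fin d) ℝ) : MemLp (quadFun h H) 2 ν := by
  refine ((memLp_one_add_norm_sq ν).const_mul (‖WithLp.toLp 2 h‖ + specNorm H)).mono
    (continuous_quadFun h H).aestronglyMeasurable (.of_forall fun x => ?_)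
  exact (abs_quadFun_le h H x).trans (le_abs_self _)

/-- All means with the same covariance are thereby compared under a single centred law. -/
theorem multivariateGaussian_eq_map_add (a : EuclideanSpace ℝ (Fin d))
    (S : Matrix (Fin d) (Fin d) ℝ) :
    multivariateGaussian a S = (multivariateGaussian 0 S).map (fun x => a + x) := by
  simp only [multivariateGaussian]
  rw [Measure.map_map (by fun_prop) (by fun_prop)]
  simp [Function.comp_def]

theorem exists_variance_quadFun_le (S : Matrix (Fin d) (Fin d) ℝ) (h : Fin d → ℝ)
    (H : Matrix (Fin d) (Fin d) ℝ) (R : ℝ) :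
    ∃ V, ∀ a : EuclideanSpace ℝ (Fin d), ‖a‖ ≤ R →
      Var[quadFun h H; multivariateGaussian a S] ≤ V := by
  set c := ‖WithLp.toLp 2 h‖ + specNorm H with hc
  have hc0 : 0 ≤ c := add_nonneg (norm_nonneg _) (norm_nonneg _)
  -- A majorant independent of a: the factor 2 + 2R² comes from ‖a + z‖² ≤ 2R² + 2‖z‖².
  set g : EuclideanSpace ℝ (Fin d) → ℝ := fun z => (c * (2 + 2 * R ^ 2)) * (1 + ‖z‖ ^ 2)
  refine ⟨∫ z, g z ^ 2 ∂(multivariateGaussian 0 S), fun a ha => ?_⟩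
  refine (variance_le_expectation_sq (continuous_quadFun h H).aestronglyMeasurable).trans ?_
  rw [multivariateGaussian_eq_map_add, integral_map (by fun_prop)
    ((continuous_quadFun h H).pow 2).aestronglyMeasurable]
  refine integral_mono_of_nonneg (.of_forall fun z => sq_nonneg _)
    ((memLp_one_add_norm_sq _).const_mul _).integrable_sq (.of_forall fun z => ?_)
  refine sq_le_sq.2 ((abs_quadFun_le h H _).trans ((?_ : _ ≤ g z).trans (le_abs_self _)))
  have h1 : ‖a + z‖ ^ 2 ≤ 2 * R ^ 2 + 2 * ‖z‖ ^ 2 := by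
    have h2 : ‖a + z‖ ≤ R + ‖z‖ := (norm_add_le a z).trans (by gcongr)
    nlinarith [sq_nonneg (R - ‖z‖), norm_nonneg (a + z)]
  have h3 : 1 + ‖a + z‖ ^ 2 ≤ (2 + 2 * R ^ 2) * (1 + ‖z‖ ^ 2) := by
    nlinarith [mul_nonneg (sq_nonneg R) (sq_nonneg ‖z‖)]
  calc c * (1 + ‖a + z‖ ^ 2) ≤ c * ((2 + 2 * R ^ 2) * (1 + ‖z‖ ^ 2)) := by gcongr
    _ = g z := by simp only [g]; ring

/-- Expand in coordinates and use that the mean of xᵢxⱼ is Sᵢⱼ + aᵢaⱼ. -/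
theorem integral_quadFun (a : EuclideanSpace ℝ (Fin d)) {S : Matrix (Fin d) (Fin d) ℝ}
    (hS : S.PosSemidef) (h : Fin d → ℝ) (H : Matrix (Fin d) (Fin d) ℝ) :
    ∫ x, quadFun h H x ∂(multivariateGaussian a S) = quadFun h H a + (1 / 2) * (S * H).trace := by
  have hL : ∀ i : Fin d, MemLp (fun x : EuclideanSpace ℝ (Fin d) => x i) 2
      (multivariateGaussian a S) := fun i =>
    (EuclideanSpace.proj (𝕜 := ℝ) i).comp_memLp' IsGaussian.memLp_two_id
  have h1 : ∀ i : Fin d, ∫ x, x i ∂(multivariateGaussian a S) = a i := fun i => by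
    have := (EuclideanSpace.proj (𝕜 := ℝ) i).integral_comp_id_comm
      (IsGaussian.integrable_id (μ := multivariateGaussian a S))
    rw [integral_id_multivariateGaussian] at this
    exact this
  have h2 : ∀ i j : Fin d, ∫ x, x i * x j ∂(multivariateGaussian a S) = S i j + a i * a j :=
    fun i j => by
      have h3 := covariance_eq_sub (hL i) (hL j)
      rw [covariance_eval_multivariateGaussian hS, h1, h1] at h3
      simp only [Pi.mul_apply] at h3
      linarith
  have hi : ∀ i j : Fin d, Integrable (fun x : EuclideanSpace ℝ (Fin d) => x i * x j)
      (multivariateGaussian a S) := fun i j => (hL i).integrable_mul (hL j)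
  have hq : ∀ x : EuclideanSpace ℝ (Fin d), quadFun h H x
      = ∑ i, h i * x i + (1 / 2) * ∑ i, ∑ j, H i j * (x i * x j) := fun x => by
    simp only [quadFun, dotProduct, mulVec, Finset.mul_sum]
    congr! 4
    ring
  simp_rw [hq]
  rw [integral_add, integral_const_mul, integral_finsetSum, integral_finsetSum]
  · have e1 : ∀ i, ∫ x : EuclideanSpace ℝ (Fin d), ∑ j, H i j * (x i * x j)
        ∂(multivariateGaussian a S) = ∑ j, H i j * (S i j + a i * a j) := fun i => by
      rw [integral_finsetSum _ fun j _ => (hi i j).const_mul _]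
      simp_rw [integral_const_mul, h2]
    simp_rw [e1, integral_const_mul, h1, mul_add, Finset.sum_add_distrib]
    have e2 : ∑ i, ∑ j, H i j * S i j = (S * H).trace := by
      rw [Matrix.trace_mul_comm]
      have hT : ∀ i j, S i j = S j i := fun i j => by simpa using (hS.1.apply i j).symm
      simp only [Matrix.trace, Matrix.diag_apply, Matrix.mul_apply]
      exact Finset.sum_congr rfl fun i _ => Finset.sum_congr rfl fun j _ => by rw [hT]
    rw [e2]
    ring
  · exact fun i _ => integrable_finsetSum _ fun j _ => (hi i j).const_mul _
  · exact fun i _ => ((hL i).integrable (by norm_num)).const_mul _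
  · exact integrable_finsetSum _ fun i _ => ((hL i).integrable (by norm_num)).const_mul _
  · exact (integrable_finsetSum _ fun i _ =>
      integrable_finsetSum _ fun j _ => (hi i j).const_mul _).const_mul _

end Gaussian

/-! ### Existence of the left inverse C -/

section LeftInverse

variable {m d : ℕ}

theorem matB_mulVec_ext1 (A : Matrix (Fin d) (Fin m ⊕ Unit) ℝ) (u : Fin m → ℝ) :
    matB A *ᵥ ext1 u = ext1 (A *ᵥ ext1 u) := by
  ext i
  rcases i with i | i
  · rfl
  · simp [matB, Matrix.mulVec, ext1]

/-- The last row of B forces the last coordinate of a kernel vector to vanish; independence of the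
first m columns of A then kills the others. So B is injective. -/
theorem exists_left_inverse_matB {A : Matrix (Fin d) (Fin m ⊕ Unit) ℝ}
    (hA : LinearIndependent ℝ (fun j : Fin m => A.col (Sum.inl j))) :
    ∃ C : Matrix (Fin m ⊕ Unit) (Fin d ⊕ Unit) ℝ, C * matB A = 1 := by
  have hinj : Function.Injective (matB A).mulVecLin := by
    refine (injective_iff_map_eq_zero _).2 fun w hw => ?_
    have hw' : matB A *ᵥ w = 0 := hw
    have h0 : w (Sum.inr ()) = 0 := by
      simpa [matB, Matrix.mulVec] using congrFun hw' (Sum.inr ())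
    have h1 : ∑ j : Fin m, w (Sum.inl j) • A.col (Sum.inl j) = 0 := by
      ext i
      have := congrFun hw' (Sum.inl i)
      simpa [matB, Matrix.mulVec, dotProduct, h0, mul_comm] using this
    have h2 := Fintype.linearIndependent_iff.1 hA _ h1
    ext j
    rcases j with j | j
    · exact h2 j
    · exact h0
  obtain ⟨g, hg⟩ := (matB A).mulVecLin.exists_leftInverse_of_injective (LinearMap.ker_eq_bot.2 hinj)
  refine ⟨LinearMap.toMatrix' g, ?_⟩
  have hB : LinearMap.toMatrix' (matB A).mulVecLin = matB A := LinearMap.toMatrix'_toLin' _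
  rw [← LinearMap.toMatrix'_id, ← hg, LinearMap.toMatrix'_comp, hB]

end LeftInverse

/-! ### Algebra of (h̄, H̄) -/

section Barred

variable {m d : ℕ} {Q : Matrix (Fin m ⊕ Unit) (Fin m ⊕ Unit) ℝ}

theorem HBar_isSymm (C : Matrix (Fin m ⊕ Unit) (Fin d ⊕ Unit) ℝ) (hQ : Q.IsSymm) :
    (HBar C Q).IsSymm := by
  have hS : (Cᵀ * Q * C).IsSymm := by
    unfold Matrix.IsSymm
    rw [transpose_mul, transpose_mul, transpose_transpose, hQ.eq, Matrix.mul_assoc]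
  ext i j
  simp only [transpose_apply, HBar, zeroCorner, fromBlocks_apply₁₁, toBlocks₁₁, of_apply]
  rw [hS.apply]

theorem zeroCorner_eq_sub (S : Matrix (Fin d ⊕ Unit) (Fin d ⊕ Unit) ℝ) :
    zeroCorner S = S - Matrix.single (Sum.inr ()) (Sum.inr ()) (S (Sum.inr ()) (Sum.inr ())) := by
  ext i j
  rcases i with i | i <;> rcases j with j | j <;>
    simp [zeroCorner, Matrix.single, toBlocks₁₁, toBlocks₁₂, toBlocks₂₁]

theorem matB_conj_corner (A : Matrix (Fin d) (Fin m ⊕ Unit) ℝ)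
    (Z : Matrix (Fin m ⊕ Unit) (Fin m ⊕ Unit) ℝ) :
    (matB A * Z * (matB A)ᵀ) (Sum.inr ()) (Sum.inr ()) = Z (Sum.inr ()) (Sum.inr ()) := by
  simp [matB, Matrix.mul_apply, Pi.single_apply]

/-- The lifted quadratic form recovers `Tr(Q Z)` up to the corner of `Cᵀ Q C`. -/
theorem half_trace_mul_bordered_bar (hQ : Q.IsSymm) {A : Matrix (Fin d) (Fin m ⊕ Unit) ℝ}
    {C : Matrix (Fin m ⊕ Unit) (Fin d ⊕ Unit) ℝ} (hC : C * matB A = 1)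
    {Z : Matrix (Fin m ⊕ Unit) (Fin m ⊕ Unit) ℝ} (hZ : Z (Sum.inr ()) (Sum.inr ()) = 1) :
    (1 / 2) * (matB A * Z * (matB A)ᵀ * bordered (hBar C Q) (HBar C Q)).trace
      = (Q * Z).trace - (Cᵀ * Q * C) (Sum.inr ()) (Sum.inr ()) := by
  have hC' : (matB A)ᵀ * Cᵀ = 1 := by rw [← transpose_mul, hC, transpose_one]
  have h1 : (matB A * Z * (matB A)ᵀ * (Cᵀ * Q * C)).trace = (Q * Z).trace := by
    calc (matB A * Z * (matB A)ᵀ * (Cᵀ * Q * C)).trace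
        = (matB A * (Z * ((matB A)ᵀ * Cᵀ) * Q * C)).trace := by simp only [Matrix.mul_assoc]
      _ = (Z * Q * (C * matB A)).trace := by
          rw [hC', Matrix.mul_one, Matrix.trace_mul_comm, Matrix.mul_assoc (Z * Q)]
      _ = (Q * Z).trace := by rw [hC, Matrix.mul_one, Matrix.trace_mul_comm]
  -- BZBᵀ has the same corner as Z, namely 1, so deleting the corner of CᵀQC subtracts exactly that
  -- entry from the trace.
  rw [bordered_bar C Q hQ, Matrix.mul_smul, Matrix.trace_smul, zeroCorner_eq_sub, Matrix.mul_sub,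
    Matrix.trace_sub, h1, Matrix.trace_mul_single, matB_conj_corner, hZ]
  simp

theorem trace_mul_lift (u : Fin m → ℝ) :
    (Q * lift u).trace = ext1 u ⬝ᵥ (Q *ᵥ ext1 u) := by
  rw [lift, Matrix.mul_vecMulVec, Matrix.trace_vecMulVec, dotProduct_comm]

/-- In this form the mean of the estimate falls under the same trace identity as the saddle value,
taken at Z = `lift u`. -/
theorem half_trace_lift_mul_bordered (a h : Fin d → ℝ) (H : Matrix (Fin d) (Fin d) ℝ) :
    (1 / 2) * (lift a * bordered h H).trace = quadFun h H (WithLp.toLp 2 a) := by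
  rw [Matrix.trace_mul_comm, trace_mul_lift, quadFun, ext1, bordered, fromBlocks_mulVec]
  simp only [dotProduct, Fintype.sum_sum_type]
  have h1 : (replicateRow Unit h *ᵥ a) () = ∑ x, h x * a x := rfl
  have h2 : ∀ x, (replicateCol Unit h *ᵥ fun _ => (1 : ℝ)) x = h x := fun x => by
    simp [Matrix.mulVec, dotProduct]
  simp [mul_add, Finset.sum_add_distrib, h1, h2, mul_comm (a _) (h _)]
  ring

theorem matB_conj_lift (A : Matrix (Fin d) (Fin m ⊕ Unit) ℝ) (u : Fin m → ℝ) :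
    matB A * lift u * (matB A)ᵀ = lift (A *ᵥ ext1 u) := by
  rw [lift, Matrix.mul_vecMulVec, Matrix.vecMulVec_mul, Matrix.vecMul_transpose, matB_mulVec_ext1,
    lift]

theorem quadFun_bar_mean (hQ : Q.IsSymm) {A : Matrix (Fin d) (Fin m ⊕ Unit) ℝ}
    {C : Matrix (Fin m ⊕ Unit) (Fin d ⊕ Unit) ℝ} (hC : C * matB A = 1) (u : Fin m → ℝ) :
    quadFun (hBar C Q) (HBar C Q) (WithLp.toLp 2 (A *ᵥ ext1 u))
      = ext1 u ⬝ᵥ (Q *ᵥ ext1 u) - (Cᵀ * Q * C) (Sum.inr ()) (Sum.inr ()) := by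
  rw [← half_trace_lift_mul_bordered, ← matB_conj_lift, half_trace_mul_bordered_bar hQ hC,
    trace_mul_lift]
  simp [lift, vecMulVec_apply, ext1]

end Barred

/-! ### From uniform consistency to the risk -/

section Risk

variable {m k d : ℕ} {U : Set (Fin m → ℝ)} {V : Set (Fin k → ℝ)}
  {M : (Fin k → ℝ) →ᵃ[ℝ] Matrix (Fin d) (Fin d) ℝ} {A : Matrix (Fin d) (Fin m ⊕ Unit) ℝ}
  {Q : Matrix (Fin m ⊕ Unit) (Fin m ⊕ Unit) ℝ} {q : Fin k → ℝ} {ε : ℝ}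

instance (u : Fin m → ℝ) (v : Fin k → ℝ) : IsGaussian (obsLaw M A u v) :=
  isGaussian_multivariateGaussian

/-- For negative ρ the deviation event is the whole space, whose probability 1 exceeds ε. -/
theorem risk_nonneg (hU : U.Nonempty) (hV : V.Nonempty) (hε1 : ε < 1) (K : ℕ)
    (g : (Fin K → EuclideanSpace ℝ (Fin d)) → ℝ) : 0 ≤ risk U V M A Q q ε K g := by
  refine le_sInf ?_
  rintro _ ⟨ρ, hρ, rfl⟩
  obtain ⟨u, hu⟩ := hU
  obtain ⟨v, hv⟩ := hV
  refine EReal.coe_nonneg.2 (not_lt.1 fun hneg => ?_)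
  have h := hρ u hu v hv
  have huniv : {ζ | ρ < |g ζ - functionalF Q q u v|} = Set.univ :=
    Set.eq_univ_of_forall fun ζ => hneg.trans_le (abs_nonneg _)
  rw [huniv, measure_univ] at h
  exact absurd h (not_le.2 (ENNReal.ofReal_lt_one.2 hε1))

theorem tendsto_risk_zero (hU : U.Nonempty) (hV : V.Nonempty) (hε1 : ε < 1)
    {g : (K : ℕ) → (Fin K → EuclideanSpace ℝ (Fin d)) → ℝ}
    (hg : ∀ ρ > 0, ∀ᶠ K in atTop, ∀ u ∈ U, ∀ v ∈ V,
      Measure.pi (fun _ : Fin K => obsLaw M A u v) {ζ | ρ < |g K ζ - functionalF Q q u v|}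
        ≤ ENNReal.ofReal ε) :
    Tendsto (fun K => risk U V M A Q q ε K (g K)) atTop (𝓝 0) := by
  refine tendsto_order.2 ⟨fun a ha => .of_forall fun K =>
    ha.trans_le (risk_nonneg hU hV hε1 K _), fun b hb => ?_⟩
  obtain ⟨ρ, hρ0, hρb⟩ := EReal.lt_iff_exists_real_btwn.1 hb
  filter_upwards [hg ρ (EReal.coe_pos.1 hρ0)] with K hK
  refine lt_of_le_of_lt (sInf_le ?_) hρb
  exact ⟨ρ, hK, rfl⟩

/-- The `K`-sample average of a quadratic function of the observations is uniformly consistent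
over a bounded set of signals. -/
theorem eventually_estimate_deviation_le (hU : Bornology.IsBounded U) {v : Fin k → ℝ}
    (hε0 : 0 < ε) {h : Fin d → ℝ} {H : Matrix (Fin d) (Fin d) ℝ} {L : ℝ}
    (hL : ∀ u ∈ U, ∫ x, quadFun h H x ∂(obsLaw M A u v) - functionalF Q q u v = L)
    {κ : ℕ → ℝ} (hκ : Tendsto κ atTop (𝓝 (-L))) {ρ : ℝ} (hρ : 0 < ρ) :
    ∀ᶠ K in atTop, ∀ u ∈ U,
      Measure.pi (fun _ : Fin K => obsLaw M A u v)
        {ζ | ρ < |estimate K h H (κ K) ζ - functionalF Q q u v|} ≤ ENNReal.ofReal ε := by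
  obtain ⟨R, hR⟩ : ∃ R, ∀ u ∈ U, ‖WithLp.toLp 2 (A *ᵥ ext1 u)‖ ≤ R := by
    obtain ⟨R, hR⟩ := (hU.isCompact_closure).exists_bound_of_continuousOn
      (f := fun u => WithLp.toLp 2 (A *ᵥ ext1 u)) (by
        refine Continuous.continuousOn ?_
        have : Continuous (fun u : Fin m → ℝ => ext1 u) := continuous_pi fun i => by
          rcases i with i | i
          · exact continuous_apply i
          · exact continuous_const
        fun_prop)
    exact ⟨R, fun u hu => hR u (subset_closure hu)⟩
  obtain ⟨V, hV⟩ := exists_variance_quadFun_le (M v) h H R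
  have hlim : Tendsto (fun K : ℕ => V / (ρ / 2) ^ 2 / K) atTop (𝓝 0) :=
    tendsto_const_div_atTop_nhds_zero_nat _
  filter_upwards [eventually_gt_atTop 0, hlim.eventually (gt_mem_nhds hε0),
    hκ.eventually (Metric.ball_mem_nhds _ (half_pos hρ))] with K hK0 hKε hKκ u hu
  -- Half of ρ is spent on the random fluctuation, by Chebyshev, and half on the distance from the
  -- shift to -L.
  refine le_trans (measure_mono fun ζ hζ => ?_) ((measure_pi_average_deviation_le
    (memLp_quadFun (obsLaw M A u v) h H) (hV _ (hR u hu)) (half_pos hρ) hK0).trans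
    (ENNReal.ofReal_le_ofReal hKε.le))
  have h1 : estimate K h H (κ K) ζ = 1 / (K : ℝ) * ∑ i, quadFun h H (ζ i) + κ K := rfl
  have h2 : |κ K - -L| < ρ / 2 := hKκ
  have h3 : ρ < |estimate K h H (κ K) ζ - functionalF Q q u v| := hζ
  have h4 : estimate K h H (κ K) ζ - functionalF Q q u v
      = (1 / (K : ℝ) * ∑ i, quadFun h H (ζ i) - ∫ x, quadFun h H x ∂(obsLaw M A u v))
        + (κ K - -L) := by
    rw [h1]; linarith [hL u hu]
  rw [h4] at h3
  show ρ / 2 ≤ |_|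
  linarith [h3.trans_le (abs_add_le _ _)]

end Risk

/-- The shift of the estimate converges to minus the bias of the unshifted estimate. -/
theorem tendsto_kappa {m k d : ℕ} (v : Fin k → ℝ)
    (M : (Fin k → ℝ) →ᵃ[ℝ] Matrix (Fin d) (Fin d) ℝ) {A : Matrix (Fin d) (Fin m ⊕ Unit) ℝ}
    {Q : Matrix (Fin m ⊕ Unit) (Fin m ⊕ Unit) ℝ} (hQ : Q.IsSymm) (q : Fin k → ℝ)
    {ε : ℝ} (hε0 : 0 < ε) (hε1 : ε < 1) {𝒵 : Set (Matrix (Fin m ⊕ Unit) (Fin m ⊕ Unit) ℝ)}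
    (hZcomp : IsCompact 𝒵) (hZne : 𝒵.Nonempty)
    (hZpos : ∀ Z ∈ 𝒵, Z.PosSemidef ∧ Z (Sum.inr ()) (Sum.inr ()) = 1)
    {Θs : Matrix (Fin d) (Fin d) ℝ} {δ γ : ℝ} (hΘ : Θs.PosDef) (hδ : 0 ≤ δ) (hγ0 : 0 < γ)
    (hγ1 : γ < 1) {C : Matrix (Fin m ⊕ Unit) (Fin d ⊕ Unit) ℝ} (hC : C * matB A = 1) :
    Tendsto (fun K => kappa {v} M A Q q ε 𝒵 Θs δ γ K (hBar C Q) (HBar C Q)) atTop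
      (𝓝 (-((1 / 2) * (M v * HBar C Q).trace - (Cᵀ * Q * C) (Sum.inr ()) (Sum.inr ())
        - q ⬝ᵥ v))) := by
  have hℓ : 0 ≤ Real.log (2 / ε) :=
    Real.log_nonneg ((one_le_div hε0).2 (by linarith))
  have hH := HBar_isSymm C hQ
  have hplus := tendsto_saddle hZcomp hZne (fun Z hZ => (hZpos Z hZ).1) v M hΘ hγ0 hγ1 hδ hℓ hH
    (h := hBar C Q) (matB A) (fun p => -functionalG Q q p.1 p.2)
    (L := (1 / 2) * (M v * HBar C Q).trace - (Cᵀ * Q * C) (Sum.inr ()) (Sum.inr ()) - q ⬝ᵥ v)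
    (fun Z hZ => by
      rw [half_trace_mul_bordered_bar hQ hC (hZpos Z hZ).2, functionalG]
      ring)
  -- At (-h̄, -H̄) the linear form changes sign, and so does the term in G, so the balance constant
  -- is -L.
  have hminus := tendsto_saddle hZcomp hZne (fun Z hZ => (hZpos Z hZ).1) v M hΘ hγ0 hγ1 hδ hℓ
    (H := -HBar C Q) (h := -hBar C Q) hH.neg (matB A) (fun p => functionalG Q q p.1 p.2)
    (L := -((1 / 2) * (M v * HBar C Q).trace - (Cᵀ * Q * C) (Sum.inr ()) (Sum.inr ()) - q ⬝ᵥ v))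
    (fun Z hZ => by
      have hb : bordered (-hBar C Q) (-HBar C Q) = -bordered (hBar C Q) (HBar C Q) := by
        simpa using bordered_smul (h := hBar C Q) (H := HBar C Q) (-1)
      have := half_trace_mul_bordered_bar hQ hC (hZpos Z hZ).2
      rw [hb, Matrix.mul_neg, Matrix.mul_neg, Matrix.trace_neg, Matrix.trace_neg, mul_neg, mul_neg,
        this, functionalG]
      ring)
  rw [scales_neg] at hminus
  have h := (hminus.sub hplus).const_mul (1 / 2)
  simp only [smul_neg, ← sub_eq_add_neg] at h
  convert h using 2
  · rfl
  · ring

end QuadLift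

theorem proposition5p2 (m k d : ℕ)
    -- the signal set and the known covariance parameter
    (U : Set (Fin m → ℝ)) (hUne : U.Nonempty) (hUb : Bornology.IsBounded U)
    (vbar : Fin k → ℝ)
    (M : (Fin k → ℝ) →ᵃ[ℝ] Matrix (Fin d) (Fin d) ℝ) (hM : (M vbar).PosDef)
    -- the observation matrix, with linearly independent first `m` columns
    (A : Matrix (Fin d) (Fin m ⊕ Unit) ℝ)
    (hA : LinearIndependent ℝ (fun j : Fin m => A.col (Sum.inl j)))
    -- the functional of interest and the tolerance
    (Q : Matrix (Fin m ⊕ Unit) (Fin m ⊕ Unit) ℝ) (hQ : Q.IsSymm) (q : Fin k → ℝ)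
    (ε : ℝ) (hε0 : 0 < ε) (hε1 : ε < 1)
    -- the parameters of the construction
    (𝒵 : Set (Matrix (Fin m ⊕ Unit) (Fin m ⊕ Unit) ℝ))
    (hZconv : Convex ℝ 𝒵) (hZcomp : IsCompact 𝒵)
    (hZpos : ∀ Z ∈ 𝒵, Z.PosSemidef ∧ Z (Sum.inr ()) (Sum.inr ()) = 1)
    (hUZ : ∀ u ∈ U, lift u ∈ 𝒵)
    (Θs : Matrix (Fin d) (Fin d) ℝ) (δ : ℝ) (hΘs : Dominates Θs δ {M vbar})
    (γ : ℝ) (hγ0 : 0 < γ) (hγ1 : γ < 1) :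
    (∃ C : Matrix (Fin m ⊕ Unit) (Fin d ⊕ Unit) ℝ, C * matB A = 1) ∧
    ∀ C : Matrix (Fin m ⊕ Unit) (Fin d ⊕ Unit) ℝ, C * matB A = 1 →
      Tendsto (fun K : ℕ => risk U {vbar} M A Q q ε K
        (estimate K (hBar C Q) (HBar C Q)
          (kappa {vbar} M A Q q ε 𝒵 Θs δ γ K (hBar C Q) (HBar C Q))))
        atTop (𝓝 0) := by
  refine ⟨exists_left_inverse_matB hA, fun C hC => ?_⟩
  have hZne : 𝒵.Nonempty := hUne.elim fun u hu => ⟨lift u, hUZ u hu⟩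
  refine tendsto_risk_zero hUne (Set.singleton_nonempty vbar) hε1 fun ρ hρ => ?_
  -- The bias is the same for all u, and it is the negative of the limit of the shift.
  have hbias : ∀ u ∈ U, ∫ x, quadFun (hBar C Q) (HBar C Q) x ∂(obsLaw M A u vbar)
      - functionalF Q q u vbar = (1 / 2) * (M vbar * HBar C Q).trace
        - (Cᵀ * Q * C) (Sum.inr ()) (Sum.inr ()) - q ⬝ᵥ vbar := fun u _ => by
    rw [obsLaw, integral_quadFun _ hM.posSemidef, quadFun_bar_mean hQ hC, functionalF]
    ring
  have hκ := tendsto_kappa vbar M hQ q hε0 hε1 hZcomp hZne hZpos hΘs.1 hΘs.2.1 hγ0 hγ1 hC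
  filter_upwards [eventually_estimate_deviation_le hUb hε0 hbias hκ hρ] with K hK u hu
  rintro v rfl
  exact hK u hu
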